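/- Let $p,q$ be positive integers and let $(\overline M,\overline g,J)$ be a locally metallic Riemannian manifold, i.e. a smooth Riemannian manifold with a smooth $(1,1)$-tensor field $J$ such that $J^2=pJ+qI$, $\overline g(JX,Y)=\overline g(X,JY)$ for all vector fields $X,Y$, and $\overline\nabla J=0$ for the Levi-Civita connection $\overline\nabla$ of $\overline g$ (for $p=q=1$: a locally Golden Riemannian manifold). Let $(M_T,g_1)$ and $(M_\perp,g_2)$ be Riemannian manifolds of positive dimension, let $f:M_T\to(0,\infty)$ be smooth, and let $M_T\times_f M_\perp$ be their warped product, i.e. $M_T\times M_\perp$ with the metric $\pi_1^*g_1+(f\circ\pi_1)^2\pi_2^*g_2$, where $\pi_1,\pi_2$ are the projections. Suppose that $M_T\times_f M_\perp$ is isometrically immersed in $\overline M$ as a warped product semi-invariant submanifold: each $M_T\times\{y\}$ is an invariant submanifold ($J$ maps its tangent spaces into themselves) and each $\{x\}\times M_\perp$ is an anti-invariant submanifold ($J$ maps its tangent spaces into its normal spaces) of $\overline M$. Then the warped product is non-proper, i.e. $f$ is constant on each connected component of $M_T$. -/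

import Mathlib

open Bundle Manifold
open scoped ContDiff

noncomputable section

section Ambient

variable {E H M : Type*} [NormedAddCommGroup E] [NormedSpace ℝ E] [FiniteDimensional ℝ E]
  [TopologicalSpace H] {I : ModelWithCorners ℝ E H}
  [TopologicalSpace M] [ChartedSpace H M] [IsManifold I ∞ M]
  [RiemannianBundle (fun x : M ↦ TangentSpace I x)]
  [IsContMDiffRiemannianBundle I ∞ E (fun x : M ↦ TangentSpace I x)]

/-- `nabla` is a Levi-Civita connection of the Riemannian manifold `M`: it is torsion-free and
compatible with the metric. In Mathlib's convention `nabla Y x v` is the derivative of the vector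
field `Y` at `x` in the direction `v`, and it carries meaning when `Y` is differentiable at `x`;
on such fields the two conditions determine it uniquely. -/
structure IsLeviCivita (nabla : CovariantDerivative I E (fun x : M ↦ TangentSpace I x)) : Prop where
  torsion_eq_zero : nabla.torsion = 0
  metric : ∀ (x : M) (Y Z : ∀ y : M, TangentSpace I y),
    MDifferentiableAt I I.tangent (fun y ↦ (TotalSpace.mk' E y (Y y) : TangentBundle I M)) x →
    MDifferentiableAt I I.tangent (fun y ↦ (TotalSpace.mk' E y (Z y) : TangentBundle I M)) x →
    ∀ v : TangentSpace I x,
      mfderiv I 𝓘(ℝ, ℝ) (fun y ↦ inner ℝ (Y y) (Z y)) x v =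
        inner ℝ (nabla Y x v) (Z x) + inner ℝ (Y x) (nabla Z x v)

/-- The field of endomorphisms `J` is parallel for `nabla`: `(∇_v J) Y = ∇_v (J Y) - J (∇_v Y) = 0`
for all tangent vectors `v` at `x` and all vector fields `Y` differentiable at `x`. -/
def IsParallel (nabla : CovariantDerivative I E (fun x : M ↦ TangentSpace I x))
    (J : ∀ x : M, TangentSpace I x →L[ℝ] TangentSpace I x) : Prop :=
  ∀ (x : M) (Y : ∀ y : M, TangentSpace I y),
    MDifferentiableAt I I.tangent (fun y ↦ (TotalSpace.mk' E y (Y y) : TangentBundle I M)) x →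
    ∀ v : TangentSpace I x, nabla (fun y ↦ J y (Y y)) x v = J x (nabla Y x v)

/-- `J` is a smooth `(1,1)`-tensor field which makes the Riemannian manifold `M` a metallic
Riemannian manifold, for the positive integers `p` and `q`. For `p = q = 1` this is a Golden
Riemannian manifold. -/
structure IsMetallicRiemannian (p q : ℕ)
    (J : ∀ x : M, TangentSpace I x →L[ℝ] TangentSpace I x) : Prop where
  p_pos : 0 < p
  q_pos : 0 < q
  contMDiff : ContMDiff I (I.prod 𝓘(ℝ, E →L[ℝ] E)) ∞
    (fun x ↦ (TotalSpace.mk' (E →L[ℝ] E) x (J x) :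
      TotalSpace (E →L[ℝ] E) (fun x : M ↦ TangentSpace I x →L[ℝ] TangentSpace I x)))
  sq_eq : ∀ (x : M) (v : TangentSpace I x), J x (J x v) = (p : ℝ) • J x v + (q : ℝ) • v
  compatible : ∀ (x : M) (v w : TangentSpace I x), inner ℝ (J x v) w = inner ℝ v (J x w)

/-- A locally metallic Riemannian manifold: a metallic Riemannian manifold whose structure `J` is
parallel for the Levi-Civita connection. For `p = q = 1`: a locally Golden Riemannian manifold. -/
structure IsLocallyMetallic (p q : ℕ)
    (J : ∀ x : M, TangentSpace I x →L[ℝ] TangentSpace I x) : Prop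
    extends IsMetallicRiemannian p q J where
  parallel : ∃ nabla : CovariantDerivative I E (fun x : M ↦ TangentSpace I x),
    IsLeviCivita nabla ∧ IsParallel nabla J

variable {E' H' S : Type*} [NormedAddCommGroup E'] [NormedSpace ℝ E'] [TopologicalSpace H']
  (I' : ModelWithCorners ℝ E' H') [TopologicalSpace S] [ChartedSpace H' S]

/-- The submanifold immersed by `φ : S → M` is invariant: `J (T S) ⊆ T S`. (Equality is automatic
for a metallic structure, as `J` is then injective and the tangent spaces are finite-dimensional.)
-/
def IsInvariantSubmanifold (J : ∀ x : M, TangentSpace I x →L[ℝ] TangentSpace I x)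
    (φ : S → M) : Prop :=
  ∀ (s : S) (v : TangentSpace I' s), ∃ w : TangentSpace I' s,
    J (φ s) (mfderiv I' I φ s v) = mfderiv I' I φ s w

/-- The submanifold immersed by `φ : S → M` is anti-invariant: `J (T S)` is normal to `S`. -/
def IsAntiInvariantSubmanifold (J : ∀ x : M, TangentSpace I x →L[ℝ] TangentSpace I x)
    (φ : S → M) : Prop :=
  ∀ (s : S) (v w : TangentSpace I' s),
    inner ℝ (J (φ s) (mfderiv I' I φ s v)) (mfderiv I' I φ s w) = 0

end Ambient

section Warped

variable {E₁ H₁ M₁ : Type*} [NormedAddCommGroup E₁] [NormedSpace ℝ E₁]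
  [TopologicalSpace H₁] (I₁ : ModelWithCorners ℝ E₁ H₁)
  [TopologicalSpace M₁] [ChartedSpace H₁ M₁] [RiemannianBundle (fun x : M₁ ↦ TangentSpace I₁ x)]
  {E₂ H₂ M₂ : Type*} [NormedAddCommGroup E₂] [NormedSpace ℝ E₂]
  [TopologicalSpace H₂] (I₂ : ModelWithCorners ℝ E₂ H₂)
  [TopologicalSpace M₂] [ChartedSpace H₂ M₂] [RiemannianBundle (fun x : M₂ ↦ TangentSpace I₂ x)]

/-- The warped product metric `π₁^* g₁ + (f ∘ π₁)² π₂^* g₂` on `M₁ × M₂`. -/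
def warpedMetric (f : M₁ → ℝ) (z : M₁ × M₂) (v w : TangentSpace (I₁.prod I₂) z) : ℝ :=
  inner ℝ (mfderiv (I₁.prod I₂) I₁ Prod.fst z v) (mfderiv (I₁.prod I₂) I₁ Prod.fst z w) +
    f z.1 ^ 2 *
      inner ℝ (mfderiv (I₁.prod I₂) I₂ Prod.snd z v) (mfderiv (I₁.prod I₂) I₂ Prod.snd z w)

variable {E H M : Type*} [NormedAddCommGroup E] [NormedSpace ℝ E]
  [TopologicalSpace H] (I : ModelWithCorners ℝ E H)
  [TopologicalSpace M] [ChartedSpace H M] [RiemannianBundle (fun x : M ↦ TangentSpace I x)]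

/-- `φ` is an isometric immersion of the warped product `M₁ ×_f M₂` into `M`, where `f` is a smooth
positive function on `M₁`. (The differential of `φ` is injective by `isometric`, since the warped
product metric is positive definite.) -/
structure IsWarpedProductSubmanifold (f : M₁ → ℝ) (φ : M₁ × M₂ → M) : Prop where
  contMDiff_warping : ContMDiff I₁ 𝓘(ℝ, ℝ) ∞ f
  warping_pos : ∀ x, 0 < f x
  contMDiff : ContMDiff (I₁.prod I₂) I ∞ φ
  isometric : ∀ (z : M₁ × M₂) (v w : TangentSpace (I₁.prod I₂) z),
    inner ℝ (mfderiv (I₁.prod I₂) I φ z v) (mfderiv (I₁.prod I₂) I φ z w) =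
      warpedMetric I₁ I₂ f z v w

/-- A warped product semi-invariant submanifold `M_T ×_f M_⊥`, with `M₁ = M_T` and `M₂ = M_⊥`: the
copies `M_T × {y}` are invariant submanifolds of `M` and the copies `{x} × M_⊥` are anti-invariant
submanifolds of `M`. -/
structure IsWarpedProductSemiInvariant (J : ∀ x : M, TangentSpace I x →L[ℝ] TangentSpace I x)
    (f : M₁ → ℝ) (φ : M₁ × M₂ → M) : Prop
    extends IsWarpedProductSubmanifold I₁ I₂ I f φ where
  invariant : ∀ y : M₂, IsInvariantSubmanifold I₁ J (fun x : M₁ ↦ φ (x, y))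
  antiInvariant : ∀ x : M₁, IsAntiInvariantSubmanifold I₂ J (fun y : M₂ ↦ φ (x, y))

end Warped

end

/-!
The differential of the warping function `f` vanishes, so `f` is constant on connected components.

Let `∇` be the Levi-Civita connection of the ambient manifold, let `X` be tangent to the base
(whose copies are `J`-invariant) and `Z` tangent to the fiber (whose copies are anti-invariant),
and put `W = J X`, which is again tangent to the base. Take `X` and `Z` to be coordinate fields, so
that `∇_X Z = ∇_Z X`. Since `∇J = 0` and `J` is self-adjoint, differentiating `⟪J Z, Z⟫ = 0` along
`X` gives `⟪∇_X Z, J Z⟫ = 0`. Hence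
`⟪∇_Z W, Z⟫ = ⟪J ∇_Z X, Z⟫ = ⟪∇_X Z, J Z⟫ = 0`,
whereas `⟪∇_Z W, Z⟫ = ½ W ⟪Z, Z⟫ = f df(W) g₂(Z, Z)` for the warped product metric. So `df(W) = 0`,
and every vector tangent to the base is of the form `J X`, because `J² = p J + q` with `q ≠ 0`.

Only values and first derivatives at one point enter. The field `W = J X` is not a coordinate
field, so the computation (`fderiv_warping_eq_zero`) replaces it by the coordinate field which
agrees with it at the point, and transfers the information through `⟪W, ∇_Z Z⟫`.

No connection pulled back along the immersion is needed: in a chart of the ambient manifold, `∇` is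
given at a point by symmetric Christoffel symbols (`IsLeviCivita.exists_christoffel`), which
express the derivatives of the metric and of `J`, and the covariant derivative along a map between
vector spaces is then an explicit formula (`covDerivAlong`).
-/

/-! ### Covariant derivatives along a map, in coordinates -/

section AlongMap

open Filter Topology

variable {N E : Type*} [NormedAddCommGroup N] [NormedSpace ℝ N]
  [NormedAddCommGroup E] [NormedSpace ℝ E]

/-- The covariant derivative at `n₀` of a vector field along a map `F : N → E`, given by its
coordinates `c : N → E`: for Christoffel symbols `Γ` at `F n₀` it is
`∇_v c = Dc(v) + Γ(c, DF(v))`. -/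
noncomputable def covDerivAlong (Γ : E →L[ℝ] E →L[ℝ] E) (F c : N → E) (n₀ : N) : N →L[ℝ] E :=
  fderiv ℝ c n₀ + (Γ (c n₀)).comp (fderiv ℝ F n₀)

theorem covDerivAlong_apply (Γ : E →L[ℝ] E →L[ℝ] E) (F c : N → E) (n₀ v : N) :
    covDerivAlong Γ F c n₀ v = fderiv ℝ c n₀ v + Γ (c n₀) (fderiv ℝ F n₀ v) := rfl

/-- Metric compatibility of the covariant derivative along a map. -/
theorem fderiv_metric_along {Γ : E →L[ℝ] E →L[ℝ] E} {F : N → E} {n₀ : N}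
    {G : N → E →L[ℝ] E →L[ℝ] ℝ} (hG : DifferentiableAt ℝ G n₀)
    (hcompat : ∀ v u w, fderiv ℝ G n₀ v u w =
      G n₀ (Γ u (fderiv ℝ F n₀ v)) w + G n₀ u (Γ w (fderiv ℝ F n₀ v)))
    {c d : N → E} (hc : DifferentiableAt ℝ c n₀) (hd : DifferentiableAt ℝ d n₀) (v : N) :
    fderiv ℝ (fun n ↦ G n (c n) (d n)) n₀ v =
      G n₀ (covDerivAlong Γ F c n₀ v) (d n₀) + G n₀ (c n₀) (covDerivAlong Γ F d n₀ v) := by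
  have h := ((hG.hasFDerivAt.clm_apply hc.hasFDerivAt).clm_apply hd.hasFDerivAt).fderiv
  rw [h]
  simp [covDerivAlong_apply, hcompat]
  ring

/-- If `J` is parallel, it commutes with the covariant derivative along a map. -/
theorem covDerivAlong_clm {Γ : E →L[ℝ] E →L[ℝ] E} {F : N → E} {n₀ : N}
    {J : N → E →L[ℝ] E} (hJ : DifferentiableAt ℝ J n₀)
    (hpar : ∀ v u, fderiv ℝ J n₀ v u + Γ (J n₀ u) (fderiv ℝ F n₀ v) =
      J n₀ (Γ u (fderiv ℝ F n₀ v)))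
    {c : N → E} (hc : DifferentiableAt ℝ c n₀) (v : N) :
    covDerivAlong Γ F (fun n ↦ J n (c n)) n₀ v = J n₀ (covDerivAlong Γ F c n₀ v) := by
  rw [covDerivAlong_apply, covDerivAlong_apply,
    (hJ.hasFDerivAt.clm_apply hc.hasFDerivAt).fderiv, map_add, ← hpar]
  simp
  abel

/-- Absence of torsion, for the covariant derivative along a map `F`: `∇_v (∂_w F) = ∇_w (∂_v F)`.
It combines the symmetry of the Christoffel symbols with that of the second derivative. -/
theorem covDerivAlong_fderiv_comm {Γ : E →L[ℝ] E →L[ℝ] E} (hΓ : ∀ u v, Γ u v = Γ v u)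
    {F : N → E} {n₀ : N} (hF : ContDiffAt ℝ 2 F n₀) (v w : N) :
    covDerivAlong Γ F (fun n ↦ fderiv ℝ F n w) n₀ v =
      covDerivAlong Γ F (fun n ↦ fderiv ℝ F n v) n₀ w := by
  have hF' : DifferentiableAt ℝ (fderiv ℝ F) n₀ :=
    (hF.fderiv_right (m := 1) (by norm_num)).differentiableAt (by simp)
  have hsymm : IsSymmSndFDerivAt ℝ F n₀ := hF.isSymmSndFDerivAt (by simp)
  have key (u : N) : fderiv ℝ (fun n ↦ fderiv ℝ F n u) n₀ = (fderiv ℝ (fderiv ℝ F) n₀).flip u := by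
    rw [(hF'.hasFDerivAt.clm_apply (hasFDerivAt_const u n₀)).fderiv]
    ext; simp
  rw [covDerivAlong_apply, covDerivAlong_apply, key, key, hΓ]
  simp [hsymm.eq v w]

end AlongMap

/-! ### The computation in coordinates -/

section Calculus

open Filter Topology

variable {E₁ E₂ E : Type*} [NormedAddCommGroup E₁] [NormedSpace ℝ E₁]
  [NormedAddCommGroup E₂] [NormedSpace ℝ E₂] [NormedAddCommGroup E] [NormedSpace ℝ E]

/-- The computation at the heart of the argument, in local coordinates. Write `X = ∂_x F`,
`W = ∂_w F` for two directions of the base, with `J X = W` at the point, and `Z = ∂_z F` for a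
direction of the fiber. Differentiating `⟪J Z, Z⟫ = 0` along `X` gives `⟪∇_X Z, J Z⟫ = 0`;
differentiating `⟪J X, Z⟫ = 0` along `Z` then gives `⟪W, ∇_Z Z⟫ = 0`; differentiating
`⟪W, Z⟫ = 0` along `Z` gives `⟪∇_W Z, Z⟫ = 0`, so that `⟪Z, Z⟫ = h² k` has derivative zero along
`W`. -/
theorem fderiv_warping_eq_zero {Γ : E →L[ℝ] E →L[ℝ] E} (hΓ : ∀ u v, Γ u v = Γ v u)
    {F : E₁ × E₂ → E} {a₀ : E₁} {b₀ : E₂} (hF : ContDiffAt ℝ 2 F (a₀, b₀))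
    {G : E₁ × E₂ → E →L[ℝ] E →L[ℝ] ℝ} (hG : DifferentiableAt ℝ G (a₀, b₀))
    (hGsymm : ∀ u v, G (a₀, b₀) u v = G (a₀, b₀) v u)
    (hcompat : ∀ v u w, fderiv ℝ G (a₀, b₀) v u w =
      G (a₀, b₀) (Γ u (fderiv ℝ F (a₀, b₀) v)) w + G (a₀, b₀) u (Γ w (fderiv ℝ F (a₀, b₀) v)))
    {J : E₁ × E₂ → E →L[ℝ] E} (hJ : DifferentiableAt ℝ J (a₀, b₀))
    (hJsymm : ∀ u v, G (a₀, b₀) (J (a₀, b₀) u) v = G (a₀, b₀) u (J (a₀, b₀) v))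
    (hpar : ∀ v u, fderiv ℝ J (a₀, b₀) v u + Γ (J (a₀, b₀) u) (fderiv ℝ F (a₀, b₀) v) =
      J (a₀, b₀) (Γ u (fderiv ℝ F (a₀, b₀) v)))
    {h : E₁ → ℝ} (hh : DifferentiableAt ℝ h a₀) (hpos : 0 < h a₀)
    {z : E₂} {k : ℝ} (hk : 0 < k) {x w : E₁}
    (hZZ : ∀ᶠ a in 𝓝 a₀,
      G (a, b₀) (fderiv ℝ F (a, b₀) (0, z)) (fderiv ℝ F (a, b₀) (0, z)) = h a ^ 2 * k)
    (hWZ : ∀ᶠ n in 𝓝 (a₀, b₀), G n (fderiv ℝ F n (w, 0)) (fderiv ℝ F n (0, z)) = 0)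
    (hJZZ : ∀ᶠ n in 𝓝 (a₀, b₀), G n (J n (fderiv ℝ F n (0, z))) (fderiv ℝ F n (0, z)) = 0)
    (hJXZ : ∀ᶠ n in 𝓝 (a₀, b₀), G n (J n (fderiv ℝ F n (x, 0))) (fderiv ℝ F n (0, z)) = 0)
    (hJX : J (a₀, b₀) (fderiv ℝ F (a₀, b₀) (x, 0)) = fderiv ℝ F (a₀, b₀) (w, 0)) :
    fderiv ℝ h a₀ w = 0 := by
  have hd (v : E₁ × E₂) : DifferentiableAt ℝ (fun n ↦ fderiv ℝ F n v) (a₀, b₀) :=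
    ((hF.fderiv_right (m := 1) (by norm_num)).differentiableAt (by simp)).clm_apply
      (differentiableAt_const v)
  have hJd (v : E₁ × E₂) : DifferentiableAt ℝ (fun n ↦ J n (fderiv ℝ F n v)) (a₀, b₀) :=
    hJ.clm_apply (hd v)
  have hzero {g : E₁ × E₂ → ℝ} (hg : ∀ᶠ n in 𝓝 (a₀, b₀), g n = 0) (v : E₁ × E₂) :
      fderiv ℝ g (a₀, b₀) v = 0 := by
    rw [EventuallyEq.fderiv_eq (f := fun _ ↦ 0) hg]; simp
  -- `⟪∇_X Z, J Z⟫ = 0`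
  have e₁ := fderiv_metric_along hG hcompat (hJd (0, z)) (hd (0, z)) (x, 0)
  rw [hzero hJZZ, covDerivAlong_clm hJ hpar (hd _), hJsymm, hGsymm (J _ _)] at e₁
  -- `⟪∇_Z X, J Z⟫ + ⟪W, ∇_Z Z⟫ = 0`
  have e₂ := fderiv_metric_along hG hcompat (hJd (x, 0)) (hd (0, z)) (0, z)
  rw [hzero hJXZ, covDerivAlong_clm hJ hpar (hd _), hJsymm, hJX,
    covDerivAlong_fderiv_comm hΓ hF] at e₂
  -- `⟪∇_W Z, Z⟫ + ⟪W, ∇_Z Z⟫ = 0`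
  have e₃ := fderiv_metric_along hG hcompat (hd (w, 0)) (hd (0, z)) (0, z)
  rw [hzero hWZ, covDerivAlong_fderiv_comm hΓ hF] at e₃
  -- the derivative of `⟪Z, Z⟫` along `W` is `2 ⟪∇_W Z, Z⟫`
  have e₄ := fderiv_metric_along hG hcompat (hd (0, z)) (hd (0, z)) (w, 0)
  rw [hGsymm (fderiv ℝ F _ _)] at e₄
  have hGF : DifferentiableAt ℝ (fun n ↦ G n (fderiv ℝ F n (0, z)) (fderiv ℝ F n (0, z)))
      (a₀, b₀) := (hG.clm_apply (hd _)).clm_apply (hd _)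
  have e₅ : fderiv ℝ (fun n ↦ G n (fderiv ℝ F n (0, z)) (fderiv ℝ F n (0, z))) (a₀, b₀) (w, 0) =
      2 * h a₀ * fderiv ℝ h a₀ w * k := by
    have h₁ := (HasFDerivAt.comp (f := fun a ↦ (a, b₀)) a₀ hGF.hasFDerivAt
      (hasFDerivAt_prodMk_left a₀ b₀)).fderiv
    have h₂ := ((hh.hasFDerivAt.pow 2).mul_const k).fderiv
    have h₃ := EventuallyEq.fderiv_eq (𝕜 := ℝ) hZZ
    have h₄ := congrArg (fun T ↦ T w) (h₁.symm.trans (h₃.trans h₂))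
    simp at h₄
    rw [h₄]; ring
  have e₆ : 2 * h a₀ * fderiv ℝ h a₀ w * k = 0 := by
    rw [← e₅, e₄]; linarith
  have : fderiv ℝ h a₀ w * (2 * h a₀ * k) = 0 := by linarith
  exact (mul_eq_zero.1 this).resolve_right (by positivity)

end Calculus

/-! ### Tangent vectors, brackets and connections in a chart -/

section Coordinates

open Filter Topology

variable {E H M : Type*} [NormedAddCommGroup E] [NormedSpace ℝ E]
  [TopologicalSpace H] {I : ModelWithCorners ℝ E H}
  [TopologicalSpace M] [ChartedSpace H M] [IsManifold I ∞ M]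

variable (I) in
/-- The coordinates at `m` of tangent vectors, in the preferred chart at `m₀`. They are the
derivative of the chart if `m` lies in its source, and zero otherwise. -/
noncomputable def tangentCoord (m₀ m : M) : TangentSpace I m →L[ℝ] E :=
  (trivializationAt E (TangentSpace I) m₀).continuousLinearMapAt ℝ m

variable (I) in
/-- The tangent vector at `m` with given coordinates in the preferred chart at `m₀`. For fixed
coordinates and varying `m`, this is a constant coefficient vector field near `m₀`. -/
noncomputable def tangentOfCoord (m₀ m : M) : E →L[ℝ] TangentSpace I m :=
  (trivializationAt E (TangentSpace I) m₀).symmL ℝ m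

theorem tangentOfCoord_tangentCoord {m₀ m : M} (hm : m ∈ (chartAt H m₀).source)
    (v : TangentSpace I m) : tangentOfCoord I m₀ m (tangentCoord I m₀ m v) = v :=
  (trivializationAt E (TangentSpace I) m₀).symmL_continuousLinearMapAt (R := ℝ) hm v

theorem tangentCoord_tangentOfCoord {m₀ m : M} (hm : m ∈ (chartAt H m₀).source)
    (u : E) : tangentCoord I m₀ m (tangentOfCoord I m₀ m u) = u :=
  (trivializationAt E (TangentSpace I) m₀).continuousLinearMapAt_symmL (R := ℝ) hm u

theorem tangentCoord_eq_mfderiv {m₀ m : M} (hm : m ∈ (chartAt H m₀).source) :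
    tangentCoord I m₀ m = mfderiv I 𝓘(ℝ, E) (extChartAt I m₀) m :=
  TangentBundle.continuousLinearMapAt_trivializationAt hm

theorem eventually_mem_chart_source (m₀ : M) : ∀ᶠ m in 𝓝 m₀, m ∈ (chartAt H m₀).source :=
  (chartAt H m₀).open_source.mem_nhds (mem_chart_source H m₀)

theorem mdifferentiableAt_iff_tangentCoord {m₀ : M} {Y : ∀ m : M, TangentSpace I m} :
    MDifferentiableAt I I.tangent (fun m ↦ (TotalSpace.mk' E m (Y m) : TangentBundle I M)) m₀ ↔
      MDifferentiableAt I 𝓘(ℝ, E) (fun m ↦ tangentCoord I m₀ m (Y m)) m₀ := by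
  refine (mdifferentiableAt_section I Y).trans (EventuallyEq.mdifferentiableAt_iff ?_)
  filter_upwards [eventually_mem_chart_source (H := H) m₀] with m hm
  have hm' : m ∈ (trivializationAt E (TangentSpace I) m₀).baseSet := hm
  rw [tangentCoord, Trivialization.continuousLinearMapAt_apply,
    Trivialization.coe_linearMapAt_of_mem _ hm']

theorem mdifferentiableAt_tangentOfCoord (m₀ : M) (u : E) :
    MDifferentiableAt I I.tangent
      (fun m ↦ (TotalSpace.mk' E m (tangentOfCoord I m₀ m u) : TangentBundle I M)) m₀ := by
  rw [mdifferentiableAt_iff_tangentCoord]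
  refine (mdifferentiableAt_const (c := u)).congr_of_eventuallyEq ?_
  filter_upwards [eventually_mem_chart_source (H := H) m₀] with m hm
  exact tangentCoord_tangentOfCoord hm u

/-- Constant coefficient vector fields commute. -/
theorem mlieBracket_tangentOfCoord (m₀ : M) (u w : E) :
    VectorField.mlieBracket I (fun m ↦ tangentOfCoord I m₀ m u)
      (fun m ↦ tangentOfCoord I m₀ m w) m₀ = 0 := by
  have key (u : E) : ∀ y ∈ (extChartAt I m₀).target,
      VectorField.mpullbackWithin 𝓘(ℝ, E) I (extChartAt I m₀).symm
        (fun m ↦ tangentOfCoord I m₀ m u) (Set.range I) y = u := by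
    intro y hy
    have hm : (extChartAt I m₀).symm y ∈ (chartAt H m₀).source := by
      simpa using (extChartAt I m₀).map_target hy
    rw [VectorField.mpullbackWithin_apply, tangentOfCoord, TangentBundle.symmL_trivializationAt hm,
      (extChartAt I m₀).right_inv hy]
    exact (isInvertible_mfderivWithin_extChartAt_symm hy).inverse_apply_eq.2 rfl
  have hy₀ := mem_extChartAt_target (I := I) m₀
  have hev (u : E) : VectorField.mpullbackWithin 𝓘(ℝ, E) I (extChartAt I m₀).symm
        (fun m ↦ tangentOfCoord I m₀ m u) (Set.range I)
      =ᶠ[𝓝[(extChartAt I m₀).symm ⁻¹' Set.univ ∩ Set.range I] (extChartAt I m₀ m₀)]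
      fun _ ↦ u := by
    rw [Set.preimage_univ, Set.univ_inter]
    filter_upwards [extChartAt_target_mem_nhdsWithin (I := I) m₀] with y hy using key u y hy
  rw [← VectorField.mlieBracketWithin_univ, VectorField.mlieBracketWithin_apply]
  have h0 := Filter.EventuallyEq.lieBracketWithin_vectorField_eq (𝕜 := ℝ)
    (hev u) (key u _ hy₀) (hev w) (key w _ hy₀)
  have h1 : VectorField.lieBracketWithin ℝ (fun _ : E ↦ u) (fun _ ↦ w)
    ((extChartAt I m₀).symm ⁻¹' Set.univ ∩ Set.range I) (extChartAt I m₀ m₀) = 0 := by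
    simp [VectorField.lieBracketWithin]
  rw [h1] at h0
  refine (congrArg _ h0).trans (map_zero _)

variable [FiniteDimensional ℝ E]

/-- Existence of Christoffel symbols at a point: in coordinates, a covariant derivative is the
derivative plus a bilinear term. -/
theorem CovariantDerivative.exists_christoffel
    (nabla : CovariantDerivative I E (fun x : M ↦ TangentSpace I x)) (m₀ : M) :
    ∃ Γ : E →L[ℝ] E →L[ℝ] E, ∀ Y : ∀ m : M, TangentSpace I m,
      MDifferentiableAt I I.tangent (fun m ↦ (TotalSpace.mk' E m (Y m) : TangentBundle I M)) m₀ →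
      ∀ v : TangentSpace I m₀, tangentCoord I m₀ m₀ (nabla Y m₀ v) =
        mvfderiv I (fun m ↦ tangentCoord I m₀ m (Y m)) m₀ v +
          Γ (tangentCoord I m₀ m₀ (Y m₀)) (tangentCoord I m₀ m₀ v) := by
  have hm₀ := mem_chart_source H m₀
  -- `∇` minus the derivative of the coordinates is tensorial at `m₀`, as both obey the Leibniz rule
  let Φ (Y : ∀ m : M, TangentSpace I m) : E →L[ℝ] E :=
    (tangentCoord I m₀ m₀ ∘L nabla Y m₀ - mvfderiv I (fun m ↦ tangentCoord I m₀ m (Y m)) m₀) ∘L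
      tangentOfCoord I m₀ m₀
  have hΦ : TensorialAt I E Φ m₀ := by
    constructor
    · intro g σ hg hσ
      have h1 := nabla.isCovariantDerivativeOnUniv.leibniz hσ hg
      have h2 : (fun m ↦ tangentCoord I m₀ m ((g • σ) m)) =
          g • fun m ↦ tangentCoord I m₀ m (σ m) := by
        ext m; simp
      ext v
      simp only [Φ]
      rw [h1, h2, mvfderiv_smul hg (mdifferentiableAt_iff_tangentCoord.1 hσ)]
      simp [smul_sub]
    · intro σ σ' hσ hσ'
      have h1 := nabla.isCovariantDerivativeOnUniv.add hσ hσ'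
      have h2 : (fun m ↦ tangentCoord I m₀ m ((σ + σ') m)) =
          (fun m ↦ tangentCoord I m₀ m (σ m)) + fun m ↦ tangentCoord I m₀ m (σ' m) := by
        ext m; simp
      ext v
      simp only [Φ]
      rw [h1, h2, mvfderiv_add (mdifferentiableAt_iff_tangentCoord.1 hσ)
        (mdifferentiableAt_iff_tangentCoord.1 hσ')]
      simp
      abel
  refine ⟨TensorialAt.mkHom Φ m₀ hΦ ∘L tangentOfCoord I m₀ m₀, fun Y hY v ↦ ?_⟩
  rw [ContinuousLinearMap.comp_apply, tangentOfCoord_tangentCoord hm₀,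
    TensorialAt.mkHom_apply hΦ hY]
  simp [tangentOfCoord_tangentCoord hm₀]

end Coordinates

/-! ### The metric and the tensor field in a chart -/

section Evaluation

variable {E H M : Type*} [NormedAddCommGroup E] [NormedSpace ℝ E]
  [TopologicalSpace H] {I : ModelWithCorners ℝ E H} [TopologicalSpace M] [ChartedSpace H M]

theorem mvfderiv_clm_apply_const {F F' : Type*} [NormedAddCommGroup F] [NormedSpace ℝ F]
    [NormedAddCommGroup F'] [NormedSpace ℝ F'] {A : M → F →L[ℝ] F'} {m : M}
    (hA : MDifferentiableAt I 𝓘(ℝ, F →L[ℝ] F') A m) (u : F) (v : TangentSpace I m) :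
    mvfderiv I (fun y ↦ A y u) m v = mvfderiv I A m v u := by
  have h := (ContinuousLinearMap.apply ℝ F' u).hasMFDerivAt.comp m hA.hasMFDerivAt
  have h' := congrArg (fun T ↦ T v) h.mfderiv
  exact h'

theorem mvfderiv_clm_apply₂_const {F F' F'' : Type*} [NormedAddCommGroup F] [NormedSpace ℝ F]
    [NormedAddCommGroup F'] [NormedSpace ℝ F'] [NormedAddCommGroup F''] [NormedSpace ℝ F'']
    {A : M → F →L[ℝ] F' →L[ℝ] F''} {m : M}
    (hA : MDifferentiableAt I 𝓘(ℝ, F →L[ℝ] F' →L[ℝ] F'') A m) (u : F) (w : F')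
    (v : TangentSpace I m) :
    mvfderiv I (fun y ↦ A y u w) m v =
      mvfderiv I A m v u w := by
  have hAu : MDifferentiableAt I 𝓘(ℝ, F' →L[ℝ] F'') (fun y ↦ A y u) m :=
    hA.clm_apply mdifferentiableAt_const
  rw [← mvfderiv_clm_apply_const hA, ← mvfderiv_clm_apply_const hAu]

end Evaluation

section MetricCoordinates

open Filter Topology

variable {E H M : Type*} [NormedAddCommGroup E] [NormedSpace ℝ E]
  [TopologicalSpace H] {I : ModelWithCorners ℝ E H}
  [TopologicalSpace M] [ChartedSpace H M] [IsManifold I ∞ M]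

variable (I) in
/-- A field of endomorphisms of the tangent spaces, in the preferred coordinates at `m₀`. -/
noncomputable def endoCoord (J : ∀ x : M, TangentSpace I x →L[ℝ] TangentSpace I x) (m₀ m : M) :
    E →L[ℝ] E :=
  tangentCoord I m₀ m ∘L J m ∘L tangentOfCoord I m₀ m

theorem endoCoord_tangentCoord {J : ∀ x : M, TangentSpace I x →L[ℝ] TangentSpace I x}
    {m₀ m : M} (hm : m ∈ (chartAt H m₀).source) (v : TangentSpace I m) :
    endoCoord I J m₀ m (tangentCoord I m₀ m v) = tangentCoord I m₀ m (J m v) := by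
  simp [endoCoord, tangentOfCoord_tangentCoord hm]

theorem mdifferentiableAt_endoCoord {J : ∀ x : M, TangentSpace I x →L[ℝ] TangentSpace I x}
    (hJ : ContMDiff I (I.prod 𝓘(ℝ, E →L[ℝ] E)) ∞
      (fun x ↦ (TotalSpace.mk' (E →L[ℝ] E) x (J x) :
        TotalSpace (E →L[ℝ] E) (fun x : M ↦ TangentSpace I x →L[ℝ] TangentSpace I x))))
    (m₀ : M) : MDifferentiableAt I 𝓘(ℝ, E →L[ℝ] E) (endoCoord I J m₀) m₀ := by
  have h := ((contMDiffAt_section m₀).1 hJ.contMDiffAt).mdifferentiableAt (by simp)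
  refine h.congr_of_eventuallyEq ?_
  filter_upwards [eventually_mem_chart_source (H := H) m₀] with m hm
  have hm' : m ∈ (trivializationAt E (TangentSpace I) m₀).baseSet := hm
  rw [hom_trivializationAt_apply, ContinuousLinearMap.inCoordinates_eq hm' hm']
  ext v
  simp [endoCoord, tangentCoord, tangentOfCoord, Trivialization.coe_linearMapAt_of_mem _ hm',
    Trivialization.symmL_apply _ hm']

variable [RiemannianBundle (fun x : M ↦ TangentSpace I x)]

variable (I) in
/-- The Riemannian metric at `m`, in the preferred coordinates at `m₀`. -/
noncomputable def metricCoord (m₀ m : M) : E →L[ℝ] E →L[ℝ] ℝ :=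
  (innerSL ℝ (E := TangentSpace I m)).bilinearComp (tangentOfCoord I m₀ m) (tangentOfCoord I m₀ m)

theorem metricCoord_apply (m₀ m : M) (u w : E) :
    metricCoord I m₀ m u w = inner ℝ (tangentOfCoord I m₀ m u) (tangentOfCoord I m₀ m w) := rfl

theorem metricCoord_tangentCoord {m₀ m : M} (hm : m ∈ (chartAt H m₀).source)
    (v w : TangentSpace I m) :
    metricCoord I m₀ m (tangentCoord I m₀ m v) (tangentCoord I m₀ m w) = inner ℝ v w := by
  rw [metricCoord_apply, tangentOfCoord_tangentCoord hm, tangentOfCoord_tangentCoord hm]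

theorem metricCoord_comm (m₀ m : M) (u w : E) :
    metricCoord I m₀ m u w = metricCoord I m₀ m w u := by
  rw [metricCoord_apply, metricCoord_apply, real_inner_comm]

theorem mdifferentiableAt_metricCoord
    [IsContMDiffRiemannianBundle I ∞ E (fun x : M ↦ TangentSpace I x)] (m₀ : M) :
    MDifferentiableAt I 𝓘(ℝ, E →L[ℝ] E →L[ℝ] ℝ) (metricCoord I m₀) m₀ := by
  obtain ⟨g, hg, hg'⟩ := IsContMDiffRiemannianBundle.exists_contMDiff (IB := I) (n := ∞) (F := E)
    (E := fun x : M ↦ TangentSpace I x)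
  have h := ((contMDiffAt_section m₀).1 hg.contMDiffAt).mdifferentiableAt (by simp)
  refine h.congr_of_eventuallyEq ?_
  filter_upwards [eventually_mem_chart_source (H := H) m₀] with m hm
  have hm' : m ∈ (trivializationAt E (TangentSpace I) m₀).baseSet := hm
  rw [hom_trivializationAt_apply]
  ext u w
  rw [inCoordinates_apply_eq₂ hm' hm' (by simp), metricCoord_apply, hg']
  simp [tangentOfCoord, Trivialization.symmL_apply _ hm']

theorem metricCoord_endoCoord {J : ∀ x : M, TangentSpace I x →L[ℝ] TangentSpace I x}
    (hJ : ∀ (x : M) (v w : TangentSpace I x), inner ℝ (J x v) w = inner ℝ v (J x w))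
    (m₀ : M) (u w : E) :
    metricCoord I m₀ m₀ (endoCoord I J m₀ m₀ u) w =
      metricCoord I m₀ m₀ u (endoCoord I J m₀ m₀ w) := by
  have hm₀ := mem_chart_source H m₀
  simp only [metricCoord_apply, endoCoord, ContinuousLinearMap.comp_apply,
    tangentOfCoord_tangentCoord hm₀]
  exact hJ _ _ _

variable [FiniteDimensional ℝ E]
  [IsContMDiffRiemannianBundle I ∞ E (fun x : M ↦ TangentSpace I x)]

/-- The Christoffel symbols of a Levi-Civita connection for which `J` is parallel: they are
symmetric as `∇` is torsion-free and constant coefficient fields commute, and they express the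
derivatives of the coordinates of the metric and of `J`. -/
theorem IsLeviCivita.exists_christoffel
    {nabla : CovariantDerivative I E (fun x : M ↦ TangentSpace I x)} (hnabla : IsLeviCivita nabla)
    {J : ∀ x : M, TangentSpace I x →L[ℝ] TangentSpace I x}
    (hJ : ContMDiff I (I.prod 𝓘(ℝ, E →L[ℝ] E)) ∞
      (fun x ↦ (TotalSpace.mk' (E →L[ℝ] E) x (J x) :
        TotalSpace (E →L[ℝ] E) (fun x : M ↦ TangentSpace I x →L[ℝ] TangentSpace I x))))
    (hpar : IsParallel nabla J) (m₀ : M) :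
    ∃ Γ : E →L[ℝ] E →L[ℝ] E, (∀ u v, Γ u v = Γ v u) ∧
      (∀ (v : TangentSpace I m₀) (u w : E), mvfderiv I (metricCoord I m₀) m₀ v u w =
        metricCoord I m₀ m₀ (Γ u (tangentCoord I m₀ m₀ v)) w +
          metricCoord I m₀ m₀ u (Γ w (tangentCoord I m₀ m₀ v))) ∧
      (∀ (v : TangentSpace I m₀) (u : E), mvfderiv I (endoCoord I J m₀) m₀ v u +
        Γ (endoCoord I J m₀ m₀ u) (tangentCoord I m₀ m₀ v) =
          endoCoord I J m₀ m₀ (Γ u (tangentCoord I m₀ m₀ v))) := by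
  have hm₀ := mem_chart_source H m₀
  obtain ⟨Γ, hΓ⟩ := nabla.exists_christoffel m₀
  have hconst (u : E) (v : TangentSpace I m₀) :
      tangentCoord I m₀ m₀ (nabla (fun m ↦ tangentOfCoord I m₀ m u) m₀ v) =
        Γ u (tangentCoord I m₀ m₀ v) := by
    rw [hΓ _ (mdifferentiableAt_tangentOfCoord m₀ u) v, tangentCoord_tangentOfCoord hm₀]
    have : (fun m ↦ tangentCoord I m₀ m (tangentOfCoord I m₀ m u)) =ᶠ[𝓝 m₀] fun _ ↦ u := by
      filter_upwards [eventually_mem_chart_source (H := H) m₀] with m hm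
      exact tangentCoord_tangentOfCoord hm u
    have h0 : mvfderiv I (fun m ↦ tangentCoord I m₀ m (tangentOfCoord I m₀ m u)) m₀ = 0 := by
      have h1 := ((hasMFDerivAt_const (I := I) (I' := 𝓘(ℝ, E)) u m₀).congr_of_eventuallyEq
        this).mfderiv
      ext v
      rw [mvfderiv, h1]
      rfl
    rw [h0]; simp
  have hconst' (u : E) (v : TangentSpace I m₀) :
      nabla (fun m ↦ tangentOfCoord I m₀ m u) m₀ v =
        tangentOfCoord I m₀ m₀ (Γ u (tangentCoord I m₀ m₀ v)) := by
    rw [← hconst, tangentOfCoord_tangentCoord hm₀]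
  refine ⟨Γ, fun u w ↦ ?_, fun v u w ↦ ?_, fun v u ↦ ?_⟩
  · have h := (nabla.torsion_eq_zero_iff.1 hnabla.torsion_eq_zero)
      (mdifferentiableAt_tangentOfCoord m₀ u) (mdifferentiableAt_tangentOfCoord m₀ w)
    rw [mlieBracket_tangentOfCoord, sub_eq_zero] at h
    have h' := congrArg (tangentCoord I m₀ m₀) h
    rw [hconst, hconst, tangentCoord_tangentOfCoord hm₀, tangentCoord_tangentOfCoord hm₀] at h'
    exact h'.symm
  · have h := hnabla.metric m₀ _ _ (mdifferentiableAt_tangentOfCoord m₀ u)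
      (mdifferentiableAt_tangentOfCoord m₀ w) v
    rw [hconst', hconst'] at h
    rw [← mvfderiv_clm_apply₂_const (mdifferentiableAt_metricCoord (I := I) m₀)]
    exact h
  · have hJc := mdifferentiableAt_endoCoord hJ m₀
    have hJu : MDifferentiableAt I 𝓘(ℝ, E) (fun m ↦ endoCoord I J m₀ m u) m₀ :=
      (ContinuousLinearMap.apply ℝ E u).mdifferentiableAt.comp m₀ hJc
    have h := hpar m₀ _ (mdifferentiableAt_tangentOfCoord m₀ u) v
    have h' := hΓ (fun m ↦ J m (tangentOfCoord I m₀ m u)) (mdifferentiableAt_iff_tangentCoord.2 hJu)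
      v
    rw [h, hconst', ← endoCoord_tangentCoord hm₀, tangentCoord_tangentOfCoord hm₀] at h'
    rw [h', ← mvfderiv_clm_apply_const hJc]
    rfl

end MetricCoordinates

/-! ### The leaves of a warped product submanifold -/

section Warped

open Filter Topology

variable {E H M : Type*} [NormedAddCommGroup E] [NormedSpace ℝ E]
  [TopologicalSpace H] {I : ModelWithCorners ℝ E H}
  [TopologicalSpace M] [ChartedSpace H M]
  {N : Type*} [NormedAddCommGroup N] [NormedSpace ℝ N]

theorem MDifferentiableAt.differentiableAt_comp {F : Type*} [NormedAddCommGroup F]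
    [NormedSpace ℝ F] {A : M → F} {ψ : N → M} {n : N} (hA : MDifferentiableAt I 𝓘(ℝ, F) A (ψ n))
    (hψ : MDifferentiableAt 𝓘(ℝ, N) I ψ n) : DifferentiableAt ℝ (fun n ↦ A (ψ n)) n :=
  (hA.comp n hψ).differentiableAt

theorem fderiv_comp_eq_mvfderiv {F : Type*} [NormedAddCommGroup F] [NormedSpace ℝ F]
    {A : M → F} {ψ : N → M} {n : N} (hA : MDifferentiableAt I 𝓘(ℝ, F) A (ψ n))
    (hψ : MDifferentiableAt 𝓘(ℝ, N) I ψ n) (v : N) :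
    fderiv ℝ (fun n ↦ A (ψ n)) n v = mvfderiv I A (ψ n) (mfderiv 𝓘(ℝ, N) I ψ n v) := by
  have h := mfderiv_comp n hA hψ
  rw [mfderiv_eq_fderiv] at h
  exact congrArg (fun T ↦ T v) h

theorem fderiv_extChartAt_comp [IsManifold I ∞ M] {ψ : N → M} {n : N} {m₀ : M}
    (hn : ψ n ∈ (chartAt H m₀).source) (hψ : MDifferentiableAt 𝓘(ℝ, N) I ψ n) (v : N) :
    fderiv ℝ (fun n ↦ extChartAt I m₀ (ψ n)) n v =
      tangentCoord I m₀ (ψ n) (mfderiv 𝓘(ℝ, N) I ψ n v) := by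
  rw [tangentCoord_eq_mfderiv hn]
  exact fderiv_comp_eq_mvfderiv (mdifferentiableAt_extChartAt hn) hψ v

variable {E₁ H₁ M₁ : Type*} [NormedAddCommGroup E₁] [NormedSpace ℝ E₁]
  [TopologicalSpace H₁] {I₁ : ModelWithCorners ℝ E₁ H₁}
  [TopologicalSpace M₁] [ChartedSpace H₁ M₁]
  {E₂ H₂ M₂ : Type*} [NormedAddCommGroup E₂] [NormedSpace ℝ E₂]
  [TopologicalSpace H₂] {I₂ : ModelWithCorners ℝ E₂ H₂}
  [TopologicalSpace M₂] [ChartedSpace H₂ M₂]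

theorem mfderiv_slice_left {φ : M₁ × M₂ → M} {x : M₁} {y : M₂}
    (hφ : MDifferentiableAt (I₁.prod I₂) I φ (x, y)) (v : TangentSpace I₁ x) :
    mfderiv I₁ I (fun x ↦ φ (x, y)) x v =
      mfderiv (I₁.prod I₂) I φ (x, y) (mfderiv I₁ (I₁.prod I₂) (fun x ↦ (x, y)) x v) :=
  congrArg (fun T ↦ T v) (mfderiv_comp (f := fun x ↦ (x, y)) x hφ
    (mdifferentiableAt_id.prodMk mdifferentiableAt_const))

theorem mfderiv_slice_right {φ : M₁ × M₂ → M} {x : M₁} {y : M₂}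
    (hφ : MDifferentiableAt (I₁.prod I₂) I φ (x, y)) (v : TangentSpace I₂ y) :
    mfderiv I₂ I (fun y ↦ φ (x, y)) y v =
      mfderiv (I₁.prod I₂) I φ (x, y) (mfderiv I₂ (I₁.prod I₂) (fun y ↦ (x, y)) y v) :=
  congrArg (fun T ↦ T v) (mfderiv_comp (f := fun y ↦ (x, y)) y hφ
    (mdifferentiableAt_const.prodMk mdifferentiableAt_id))

variable (I₁ I₂) in
theorem mfderiv_snd_inclusion_left (x : M₁) (y : M₂) (v : TangentSpace I₁ x) :
    mfderiv (I₁.prod I₂) I₂ Prod.snd (x, y) (mfderiv I₁ (I₁.prod I₂) (fun x ↦ (x, y)) x v) = 0 := by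
  rw [← mfderiv_slice_left (φ := Prod.snd) mdifferentiableAt_snd]
  exact congrArg (fun T ↦ T v) (mfderiv_const (I := I₁) (I' := I₂) (c := y) (x := x))

variable (I₁ I₂) in
theorem mfderiv_fst_inclusion_right (x : M₁) (y : M₂) (v : TangentSpace I₂ y) :
    mfderiv (I₁.prod I₂) I₁ Prod.fst (x, y) (mfderiv I₂ (I₁.prod I₂) (fun y ↦ (x, y)) y v) = 0 := by
  rw [← mfderiv_slice_right (φ := Prod.fst) mdifferentiableAt_fst]
  exact congrArg (fun T ↦ T v) (mfderiv_const (I := I₂) (I' := I₁) (c := x) (x := y))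

variable (I₁ I₂) in
theorem mfderiv_snd_inclusion_right (x : M₁) (y : M₂) (v : TangentSpace I₂ y) :
    mfderiv (I₁.prod I₂) I₂ Prod.snd (x, y) (mfderiv I₂ (I₁.prod I₂) (fun y ↦ (x, y)) y v) = v := by
  rw [← mfderiv_slice_right (φ := Prod.snd) mdifferentiableAt_snd]
  exact congrArg (fun T ↦ T v) (mfderiv_id (I := I₂) (x := y))

variable [RiemannianBundle (fun x : M ↦ TangentSpace I x)]
  [RiemannianBundle (fun x : M₁ ↦ TangentSpace I₁ x)]
  [RiemannianBundle (fun x : M₂ ↦ TangentSpace I₂ x)] {f : M₁ → ℝ} {φ : M₁ × M₂ → M}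

/-- The base and the fibers of a warped product submanifold are orthogonal. -/
theorem IsWarpedProductSubmanifold.inner_base_fiber
    (hφ : IsWarpedProductSubmanifold I₁ I₂ I f φ) (x : M₁) (y : M₂)
    (v : TangentSpace I₁ x) (w : TangentSpace I₂ y) :
    inner ℝ (mfderiv I₁ I (fun x ↦ φ (x, y)) x v : TangentSpace I (φ (x, y)))
      (mfderiv I₂ I (fun y ↦ φ (x, y)) y w : TangentSpace I (φ (x, y))) = 0 := by
  have hd := hφ.contMDiff.mdifferentiableAt (x := (x, y)) (by simp)
  rw [mfderiv_slice_left hd, mfderiv_slice_right hd, hφ.isometric]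
  rw [warpedMetric, mfderiv_snd_inclusion_left, mfderiv_fst_inclusion_right, inner_zero_left,
    inner_zero_right, mul_zero, add_zero]

/-- The fibers of a warped product submanifold carry the metric of the fiber, scaled by the
square of the warping function. -/
theorem IsWarpedProductSubmanifold.inner_fiber_fiber
    (hφ : IsWarpedProductSubmanifold I₁ I₂ I f φ) (x : M₁) (y : M₂)
    (v w : TangentSpace I₂ y) :
    inner ℝ (mfderiv I₂ I (fun y ↦ φ (x, y)) y v : TangentSpace I (φ (x, y)))
      (mfderiv I₂ I (fun y ↦ φ (x, y)) y w : TangentSpace I (φ (x, y))) =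
        f x ^ 2 * inner ℝ v w := by
  have hd := hφ.contMDiff.mdifferentiableAt (x := (x, y)) (by simp)
  rw [mfderiv_slice_right hd, mfderiv_slice_right hd, hφ.isometric]
  rw [warpedMetric, mfderiv_fst_inclusion_right, inner_zero_left, zero_add,
    mfderiv_snd_inclusion_right, mfderiv_snd_inclusion_right]

/-- As `q ≠ 0`, a metallic structure maps the tangent spaces of the invariant leaves onto
themselves: `w` is the image under `J` of `(J w - p w) / q`. -/
theorem IsWarpedProductSemiInvariant.exists_preimage [IsManifold I ∞ M] {p q : ℕ}
    {J : ∀ x : M, TangentSpace I x →L[ℝ] TangentSpace I x}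
    (hφ : IsWarpedProductSemiInvariant I₁ I₂ I J f φ) (hJ : IsMetallicRiemannian p q J)
    (x : M₁) (y : M₂) (w : TangentSpace I₁ x) :
    ∃ v : TangentSpace I₁ x, J (φ (x, y)) (mfderiv I₁ I (fun x ↦ φ (x, y)) x v) =
      mfderiv I₁ I (fun x ↦ φ (x, y)) x w := by
  obtain ⟨u, hu⟩ := hφ.invariant y x w
  have hq : (q : ℝ) ≠ 0 := by exact_mod_cast hJ.q_pos.ne'
  refine ⟨(q : ℝ)⁻¹ • (u - (p : ℝ) • w), ?_⟩
  have h := hJ.sq_eq (φ (x, y)) (mfderiv I₁ I (fun x ↦ φ (x, y)) x w)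
  rw [map_smul, map_sub, map_smul, ← hu, map_smul, map_sub, map_smul, h, add_sub_cancel_left,
    inv_smul_smul₀ hq]

end Warped

/-! ### Charts of a manifold without boundary -/

section BaseCharts

open Filter Topology

variable {E H M : Type*} [NormedAddCommGroup E] [NormedSpace ℝ E]
  [TopologicalSpace H] {I : ModelWithCorners ℝ E H} [I.Boundaryless]
  [TopologicalSpace M] [ChartedSpace H M] [IsManifold I ∞ M]

theorem contMDiffAt_extChartAt_symm_of_boundaryless (x₀ : M) {a : E}
    (ha : a ∈ (extChartAt I x₀).target) :
    ContMDiffAt 𝓘(ℝ, E) I ∞ (extChartAt I x₀).symm a :=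
  (contMDiffOn_extChartAt_symm x₀).contMDiffAt ((isOpen_extChartAt_target x₀).mem_nhds ha)

theorem bijective_mfderiv_extChartAt_symm (x₀ : M) {a : E} (ha : a ∈ (extChartAt I x₀).target) :
    Function.Bijective (mfderiv 𝓘(ℝ, E) I (extChartAt I x₀).symm a) := by
  have h := isInvertible_mfderivWithin_extChartAt_symm (I := I) ha
  rw [I.range_eq_univ, mfderivWithin_univ] at h
  obtain ⟨e, he⟩ := h
  rw [← he]
  exact e.bijective

/-- A differentiable function with vanishing differential is constant on connected components. -/
theorem eq_of_mfderiv_eq_zero {f : M → ℝ} (hf : MDifferentiable I 𝓘(ℝ, ℝ) f)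
    (h : ∀ x, mfderiv I 𝓘(ℝ, ℝ) f x = 0) {x x' : M} (hx' : x' ∈ connectedComponent x) :
    f x' = f x := by
  have hloc : IsLocallyConstant f := by
    refine (IsLocallyConstant.iff_eventually_eq f).2 fun x₀ ↦ ?_
    obtain ⟨r, hr, hball⟩ := Metric.mem_nhds_iff.1 (extChartAt_target_mem_nhds (I := I) x₀)
    have hd (a : E) (ha : a ∈ Metric.ball (extChartAt I x₀ x₀) r) :
        HasFDerivAt (f ∘ (extChartAt I x₀).symm) (0 : E →L[ℝ] ℝ) a := by
      have h₁ := (hf ((extChartAt I x₀).symm a)).hasMFDerivAt.comp a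
        ((contMDiffAt_extChartAt_symm_of_boundaryless x₀ (hball ha)).mdifferentiableAt
          (by simp)).hasMFDerivAt
      rw [h] at h₁
      exact h₁.hasFDerivAt
    have hconst (a : E) (ha : a ∈ Metric.ball (extChartAt I x₀ x₀) r) :
        f ((extChartAt I x₀).symm a) = f x₀ := by
      have := (convex_ball (extChartAt I x₀ x₀) r).is_const_of_fderivWithin_eq_zero (𝕜 := ℝ)
        (fun a ha ↦ (hd a ha).differentiableAt.differentiableWithinAt)
        (fun a ha ↦ ((hd a ha).hasFDerivWithinAt).fderivWithin
          (Metric.isOpen_ball.uniqueDiffWithinAt ha)) ha (Metric.mem_ball_self hr)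
      simpa using this
    filter_upwards [(continuousAt_extChartAt (I := I) x₀).preimage_mem_nhds
      (Metric.ball_mem_nhds _ hr), extChartAt_source_mem_nhds (I := I) x₀] with y hy hy'
    rw [← hconst _ hy, (extChartAt I x₀).left_inv hy']
  exact hloc.apply_eq_of_isPreconnected isPreconnected_connectedComponent hx' mem_connectedComponent

end BaseCharts

/-! ### The warping function -/

section Main

open Filter Topology

theorem fderiv_apply_left {E₁ E₂ E : Type*} [NormedAddCommGroup E₁] [NormedSpace ℝ E₁]
    [NormedAddCommGroup E₂] [NormedSpace ℝ E₂] [NormedAddCommGroup E] [NormedSpace ℝ E]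
    {F : E₁ × E₂ → E} {a : E₁} {b : E₂} (hF : DifferentiableAt ℝ F (a, b)) (v : E₁) :
    fderiv ℝ F (a, b) (v, 0) = fderiv ℝ (fun a ↦ F (a, b)) a v := by
  have h := (HasFDerivAt.comp (f := fun a ↦ (a, b)) a hF.hasFDerivAt
    (hasFDerivAt_prodMk_left a b)).fderiv
  exact (congrArg (fun T ↦ T v) h).symm

theorem fderiv_apply_right {E₁ E₂ E : Type*} [NormedAddCommGroup E₁] [NormedSpace ℝ E₁]
    [NormedAddCommGroup E₂] [NormedSpace ℝ E₂] [NormedAddCommGroup E] [NormedSpace ℝ E]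
    {F : E₁ × E₂ → E} {a : E₁} {b : E₂} (hF : DifferentiableAt ℝ F (a, b)) (v : E₂) :
    fderiv ℝ F (a, b) (0, v) = fderiv ℝ (fun b ↦ F (a, b)) b v := by
  have h := (HasFDerivAt.comp (f := fun b ↦ (a, b)) b hF.hasFDerivAt
    (hasFDerivAt_prodMk_right a b)).fderiv
  exact (congrArg (fun T ↦ T v) h).symm

variable {E H M : Type*} [NormedAddCommGroup E] [NormedSpace ℝ E] [FiniteDimensional ℝ E]
  [TopologicalSpace H] {I : ModelWithCorners ℝ E H}
  [TopologicalSpace M] [ChartedSpace H M] [IsManifold I ∞ M]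
  [RiemannianBundle (fun x : M ↦ TangentSpace I x)]
  [IsContMDiffRiemannianBundle I ∞ E (fun x : M ↦ TangentSpace I x)]
  {E₁ H₁ M₁ : Type*} [NormedAddCommGroup E₁] [NormedSpace ℝ E₁]
  [TopologicalSpace H₁] {I₁ : ModelWithCorners ℝ E₁ H₁} [I₁.Boundaryless]
  [TopologicalSpace M₁] [ChartedSpace H₁ M₁] [IsManifold I₁ ∞ M₁]
  [RiemannianBundle (fun x : M₁ ↦ TangentSpace I₁ x)]
  {E₂ H₂ M₂ : Type*} [NormedAddCommGroup E₂] [NormedSpace ℝ E₂]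
  [TopologicalSpace H₂] {I₂ : ModelWithCorners ℝ E₂ H₂} [I₂.Boundaryless]
  [TopologicalSpace M₂] [ChartedSpace H₂ M₂] [IsManifold I₂ ∞ M₂]
  [RiemannianBundle (fun x : M₂ ↦ TangentSpace I₂ x)] [Nontrivial E₂]
  {p q : ℕ} {J : ∀ x : M, TangentSpace I x →L[ℝ] TangentSpace I x}
  {f : M₁ → ℝ} {φ : M₁ × M₂ → M}

/-- In charts centred at a point of the product, the warping function satisfies the hypotheses of
`fderiv_warping_eq_zero`, so its differential vanishes. -/
theorem IsWarpedProductSemiInvariant.mfderiv_warping_eq_zero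
    (hφ : IsWarpedProductSemiInvariant I₁ I₂ I J f φ) (hJ : IsLocallyMetallic p q J)
    (x₀ : M₁) (y₀ : M₂) : mfderiv I₁ 𝓘(ℝ, ℝ) f x₀ = 0 := by
  obtain ⟨nabla, hnabla, hpar⟩ := hJ.parallel
  set σ₁ := (extChartAt I₁ x₀).symm
  set σ₂ := (extChartAt I₂ y₀).symm
  set a₀ := extChartAt I₁ x₀ x₀
  set b₀ := extChartAt I₂ y₀ y₀
  let ψ : E₁ × E₂ → M := fun n ↦ φ (σ₁ n.1, σ₂ n.2)
  let m₀ : M := ψ (a₀, b₀)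
  have hm₀ : ψ (a₀, b₀) ∈ (chartAt H m₀).source := mem_chart_source H m₀
  let F : E₁ × E₂ → E := fun n ↦ extChartAt I m₀ (ψ n)
  let D₁ (a : E₁) : E₁ →L[ℝ] TangentSpace I₁ (σ₁ a) := mfderiv 𝓘(ℝ, E₁) I₁ σ₁ a
  let D₂ (b : E₂) : E₂ →L[ℝ] TangentSpace I₂ (σ₂ b) := mfderiv 𝓘(ℝ, E₂) I₂ σ₂ b
  let X (a : E₁) (b : E₂) (v : E₁) : TangentSpace I (φ (σ₁ a, σ₂ b)) :=
    mfderiv I₁ I (fun x ↦ φ (x, σ₂ b)) (σ₁ a) (D₁ a v)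
  let Z (a : E₁) (b : E₂) (z : E₂) : TangentSpace I (φ (σ₁ a, σ₂ b)) :=
    mfderiv I₂ I (fun y ↦ φ (σ₁ a, y)) (σ₂ b) (D₂ b z)
  have hσ₁d (a : E₁) (ha : a ∈ (extChartAt I₁ x₀).target) : ContMDiffAt 𝓘(ℝ, E₁) I₁ ∞ σ₁ a :=
    contMDiffAt_extChartAt_symm_of_boundaryless x₀ ha
  have hσ₂d (b : E₂) (hb : b ∈ (extChartAt I₂ y₀).target) : ContMDiffAt 𝓘(ℝ, E₂) I₂ ∞ σ₂ b :=
    contMDiffAt_extChartAt_symm_of_boundaryless y₀ hb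
  have ha₀t : a₀ ∈ (extChartAt I₁ x₀).target := mem_extChartAt_target x₀
  have hb₀t : b₀ ∈ (extChartAt I₂ y₀).target := mem_extChartAt_target y₀
  have hψ (a : E₁) (b : E₂) (ha : a ∈ (extChartAt I₁ x₀).target)
      (hb : b ∈ (extChartAt I₂ y₀).target) : ContMDiffAt 𝓘(ℝ, E₁ × E₂) I ∞ ψ (a, b) := by
    refine hφ.contMDiff.contMDiffAt.comp (a, b) (ContMDiffAt.prodMk ?_ ?_)
    · exact (hσ₁d a ha).comp (a, b) (f := Prod.fst) contDiffAt_fst.contMDiffAt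
    · exact (hσ₂d b hb).comp (a, b) (f := Prod.snd) contDiffAt_snd.contMDiffAt
  have hψ₀ : MDifferentiableAt 𝓘(ℝ, E₁ × E₂) I ψ (a₀, b₀) :=
    (hψ a₀ b₀ ha₀t hb₀t).mdifferentiableAt (by simp)
  have hF (a : E₁) (b : E₂) (ha : a ∈ (extChartAt I₁ x₀).target)
      (hb : b ∈ (extChartAt I₂ y₀).target) (hab : ψ (a, b) ∈ (chartAt H m₀).source) :
      ContDiffAt ℝ ∞ F (a, b) :=
    ((contMDiffAt_extChartAt' hab).comp (a, b) (hψ a b ha hb)).contDiffAt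
  have hev : ∀ᶠ n : E₁ × E₂ in 𝓝 (a₀, b₀), n.1 ∈ (extChartAt I₁ x₀).target ∧
      n.2 ∈ (extChartAt I₂ y₀).target ∧ ψ n ∈ (chartAt H m₀).source := by
    have h₁ : ∀ᶠ a in 𝓝 a₀, a ∈ (extChartAt I₁ x₀).target := extChartAt_target_mem_nhds x₀
    have h₂ : ∀ᶠ b in 𝓝 b₀, b ∈ (extChartAt I₂ y₀).target := extChartAt_target_mem_nhds y₀
    refine ((continuous_fst.tendsto (a₀, b₀)).eventually h₁).and
      (((continuous_snd.tendsto (a₀, b₀)).eventually h₂).and ?_)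
    exact hψ₀.continuousAt.eventually (eventually_mem_chart_source m₀)
  -- the partial derivatives of `F` are the coordinates of the vectors tangent to the leaves
  have hFX (a : E₁) (b : E₂) (ha : a ∈ (extChartAt I₁ x₀).target)
      (hb : b ∈ (extChartAt I₂ y₀).target) (hab : ψ (a, b) ∈ (chartAt H m₀).source) (v : E₁) :
      fderiv ℝ F (a, b) (v, 0) = tangentCoord I m₀ (ψ (a, b)) (X a b v) := by
    have hd : MDifferentiableAt I₁ I (fun x ↦ φ (x, σ₂ b)) (σ₁ a) :=
      (hφ.contMDiff.mdifferentiableAt (by simp)).comp (σ₁ a) (f := fun x ↦ (x, σ₂ b))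
        (mdifferentiableAt_id.prodMk mdifferentiableAt_const)
    have hd' := (hσ₁d a ha).mdifferentiableAt (by simp)
    rw [fderiv_apply_left ((hF a b ha hb hab).differentiableAt (by simp))]
    refine (fderiv_extChartAt_comp (ψ := fun a ↦ φ (σ₁ a, σ₂ b)) hab (hd.comp a hd') v).trans ?_
    exact congrArg (fun T ↦ tangentCoord I m₀ (ψ (a, b)) (T v)) (mfderiv_comp a hd hd')
  have hFZ (a : E₁) (b : E₂) (ha : a ∈ (extChartAt I₁ x₀).target)
      (hb : b ∈ (extChartAt I₂ y₀).target) (hab : ψ (a, b) ∈ (chartAt H m₀).source) (z : E₂) :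
      fderiv ℝ F (a, b) (0, z) = tangentCoord I m₀ (ψ (a, b)) (Z a b z) := by
    have hd : MDifferentiableAt I₂ I (fun y ↦ φ (σ₁ a, y)) (σ₂ b) :=
      (hφ.contMDiff.mdifferentiableAt (by simp)).comp (σ₂ b) (f := fun y ↦ (σ₁ a, y))
        (mdifferentiableAt_const.prodMk mdifferentiableAt_id)
    have hd' := (hσ₂d b hb).mdifferentiableAt (by simp)
    rw [fderiv_apply_right ((hF a b ha hb hab).differentiableAt (by simp))]
    refine (fderiv_extChartAt_comp (ψ := fun b ↦ φ (σ₁ a, σ₂ b)) hab (hd.comp b hd') z).trans ?_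
    exact congrArg (fun T ↦ tangentCoord I m₀ (ψ (a, b)) (T z)) (mfderiv_comp b hd hd')
  obtain ⟨Γ, hΓ, hcompat, hJpar⟩ := hnabla.exists_christoffel hJ.contMDiff hpar m₀
  have hFψ (v : E₁ × E₂) : fderiv ℝ F (a₀, b₀) v =
      tangentCoord I m₀ m₀ (mfderiv 𝓘(ℝ, E₁ × E₂) I ψ (a₀, b₀) v) :=
    fderiv_extChartAt_comp hm₀ hψ₀ v
  have hGd := mdifferentiableAt_metricCoord (I := I) m₀
  have hJd := mdifferentiableAt_endoCoord hJ.contMDiff m₀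
  have hGψ : DifferentiableAt ℝ (fun n ↦ metricCoord I m₀ (ψ n)) (a₀, b₀) :=
    MDifferentiableAt.differentiableAt_comp (F := E →L[ℝ] E →L[ℝ] ℝ) (ψ := ψ) hGd hψ₀
  have hJψ : DifferentiableAt ℝ (fun n ↦ endoCoord I J m₀ (ψ n)) (a₀, b₀) :=
    MDifferentiableAt.differentiableAt_comp (ψ := ψ) hJd hψ₀
  have hfd : MDifferentiable I₁ 𝓘(ℝ, ℝ) f := hφ.contMDiff_warping.mdifferentiable (by simp)
  obtain ⟨z, hz⟩ := exists_ne (0 : E₂)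
  have hz' : D₂ b₀ z ≠ 0 := fun h ↦
    hz ((bijective_mfderiv_extChartAt_symm y₀ hb₀t).injective (h.trans (map_zero (D₂ b₀)).symm))
  have hsurj (w : E₁) : ∃ x : E₁, J (ψ (a₀, b₀)) (X a₀ b₀ x) = X a₀ b₀ w := by
    obtain ⟨v, hv⟩ := hφ.exists_preimage hJ.toIsMetallicRiemannian (σ₁ a₀) (σ₂ b₀) (D₁ a₀ w)
    obtain ⟨x, hx⟩ : ∃ x, D₁ a₀ x = v := (bijective_mfderiv_extChartAt_symm x₀ ha₀t).surjective v
    exact ⟨x, by simpa only [X, hx] using hv⟩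
  have hmain (w : E₁) : fderiv ℝ (fun a ↦ f (σ₁ a)) a₀ w = 0 := by
    obtain ⟨x, hx⟩ := hsurj w
    refine fderiv_warping_eq_zero (F := F) (G := fun n ↦ metricCoord I m₀ (ψ n))
      (J := fun n ↦ endoCoord I J m₀ (ψ n)) (h := fun a ↦ f (σ₁ a)) hΓ
      (contDiffAt_infty.1 (hF a₀ b₀ ha₀t hb₀t hm₀) 2)
      hGψ
      (metricCoord_comm m₀ _) ?_ hJψ
      (metricCoord_endoCoord hJ.compatible m₀) ?_
      ((hfd _).comp a₀ ((hσ₁d a₀ ha₀t).mdifferentiableAt (by simp))).differentiableAt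
      (hφ.warping_pos _) (z := z) (k := inner ℝ (D₂ b₀ z) (D₂ b₀ z)) (real_inner_self_pos.2 hz')
      (x := x) (w := w) ?_ ?_ ?_ ?_ ?_
    · intro v u u'
      rw [fderiv_comp_eq_mvfderiv (ψ := ψ) hGd hψ₀, hFψ]
      exact hcompat _ u u'
    · intro v u
      rw [fderiv_comp_eq_mvfderiv (ψ := ψ) hJd hψ₀, hFψ]
      exact hJpar _ u
    · have : ContinuousAt (fun a : E₁ ↦ (a, b₀)) a₀ := by fun_prop
      filter_upwards [this.eventually hev] with a ha
      rw [hFZ a b₀ ha.1 hb₀t ha.2.2, metricCoord_tangentCoord ha.2.2]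
      exact hφ.inner_fiber_fiber _ _ _ _
    · filter_upwards [hev] with ⟨a, b⟩ ⟨ha, hb, hab⟩
      rw [hFX a b ha hb hab, hFZ a b ha hb hab, metricCoord_tangentCoord hab]
      exact hφ.inner_base_fiber _ _ _ _
    · filter_upwards [hev] with ⟨a, b⟩ ⟨ha, hb, hab⟩
      rw [hFZ a b ha hb hab, endoCoord_tangentCoord hab, metricCoord_tangentCoord hab]
      exact hφ.antiInvariant _ _ _ _
    · filter_upwards [hev] with ⟨a, b⟩ ⟨ha, hb, hab⟩
      rw [hFX a b ha hb hab, hFZ a b ha hb hab, endoCoord_tangentCoord hab,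
        metricCoord_tangentCoord hab]
      -- `J X` is tangent to the base by invariance, hence orthogonal to `Z`
      obtain ⟨u, hu⟩ := hφ.invariant (σ₂ b) (σ₁ a) (D₁ a x)
      refine (congrArg (fun T ↦ inner ℝ T (Z a b z)) hu).trans ?_
      exact hφ.inner_base_fiber _ _ _ _
    · -- at the base point, `J X = W` by the choice of `x`
      rw [hFX a₀ b₀ ha₀t hb₀t hm₀, hFX a₀ b₀ ha₀t hb₀t hm₀]
      exact (endoCoord_tangentCoord hm₀ _).trans (congrArg _ hx)
  have hfin : fderivWithin ℝ (writtenInExtChartAt I₁ 𝓘(ℝ, ℝ) x₀ f) (Set.range I₁) a₀ =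
      fderiv ℝ (fun a ↦ f (σ₁ a)) a₀ := by
    rw [I₁.range_eq_univ, fderivWithin_univ]
    rfl
  exact (hfd x₀).mfderiv.trans (hfin.trans (ContinuousLinearMap.ext hmain))

end Main

theorem mainTheorem2
    -- the ambient Riemannian manifold
    {E H M : Type*} [NormedAddCommGroup E] [NormedSpace ℝ E] [FiniteDimensional ℝ E]
    [TopologicalSpace H] (I : ModelWithCorners ℝ E H) [I.Boundaryless]
    [TopologicalSpace M] [ChartedSpace H M] [IsManifold I ∞ M]
    [RiemannianBundle (fun x : M ↦ TangentSpace I x)]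
    [IsContMDiffRiemannianBundle I ∞ E (fun x : M ↦ TangentSpace I x)]
    -- the base
    {E₁ H₁ MT : Type*} [NormedAddCommGroup E₁] [NormedSpace ℝ E₁] [FiniteDimensional ℝ E₁]
    [TopologicalSpace H₁] (I₁ : ModelWithCorners ℝ E₁ H₁) [I₁.Boundaryless]
    [TopologicalSpace MT] [ChartedSpace H₁ MT] [IsManifold I₁ ∞ MT]
    [RiemannianBundle (fun x : MT ↦ TangentSpace I₁ x)]
    [IsContMDiffRiemannianBundle I₁ ∞ E₁ (fun x : MT ↦ TangentSpace I₁ x)]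
    -- the fiber, nonempty and of positive dimension
    {E₂ H₂ MP : Type*} [NormedAddCommGroup E₂] [NormedSpace ℝ E₂] [FiniteDimensional ℝ E₂]
    [TopologicalSpace H₂] (I₂ : ModelWithCorners ℝ E₂ H₂) [I₂.Boundaryless]
    [TopologicalSpace MP] [ChartedSpace H₂ MP] [IsManifold I₂ ∞ MP]
    [RiemannianBundle (fun x : MP ↦ TangentSpace I₂ x)]
    [IsContMDiffRiemannianBundle I₂ ∞ E₂ (fun x : MP ↦ TangentSpace I₂ x)]
    [Nonempty MP] (hdim : 0 < Module.finrank ℝ E₂)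
    (p q : ℕ) (J : ∀ x : M, TangentSpace I x →L[ℝ] TangentSpace I x)
    (hJ : IsLocallyMetallic p q J)
    (f : MT → ℝ) (φ : MT × MP → M)
    (hφ : IsWarpedProductSemiInvariant I₁ I₂ I J f φ) :
    ∀ x : MT, ∀ x' ∈ connectedComponent x, f x' = f x := by
  have : Nontrivial E₂ := Module.nontrivial_of_finrank_pos hdim
  intro x x' hx'
  exact eq_of_mfderiv_eq_zero (hφ.contMDiff_warping.mdifferentiable (by simp))
    (fun x₀ ↦ hφ.mfderiv_warping_eq_zero hJ x₀ (Classical.arbitrary MP)) hx'
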